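/- Let $D$ be an integral domain with quotient field $K$ that is an almost GCD (AGCD) domain: for all nonzero $a,b\in D$ there is an integer $n\ge 1$ such that $(a^n)\cap(b^n)$ is principal. Then the following four statements are equivalent. 1. The power series ring $D[[X]]$ is integrally closed. 2. $D[[X]]$ is completely integrally closed. 3. $D$ is completely integrally closed. 4. $D$ is a completely integrally closed Prüfer $v$-multiplication domain (PVMD) with torsion $t$-class group. Here an integral domain $R$ with quotient field $L$ is completely integrally closed if every $x\in L$ for which there is $0\ne r\in R$ with $rx^n\in R$ for all $n\ge 1$ lies in $R$. For a nonzero fractional ideal $I$ of $D$, put $I^{-1}=\{x\in K: xI\subseteq D\}$, $I_v=(I^{-1})^{-1}$ and $I_t=\bigcup\{J_v : J\subseteq I,\ J \text{ a nonzero finitely generated fractional ideal}\}$; $I$ is a $t$-ideal if $I_t=I$, and $t$-invertible if $(II^{-1})_t=D$. $D$ is a PVMD if every nonzero finitely generated fractional ideal of $D$ is $t$-invertible. The $t$-class group is the quotient of the abelian group of $t$-invertible fractional $t$-ideals, with product $(I,J)\mapsto(IJ)_t$, by the subgroup of nonzero principal fractional ideals. -/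

import Mathlib

open scoped nonZeroDivisors

/-- For all nonzero `a, b` some `(aⁿ) ∩ (bⁿ)` with `n ≥ 1` is principal. -/
def IsAGCDDomain (D : Type*) [CommRing D] [IsDomain D] : Prop :=
  ∀ a b : D, a ≠ 0 → b ≠ 0 →
    ∃ n : ℕ, 1 ≤ n ∧ (Ideal.span {a ^ n} ⊓ Ideal.span {b ^ n} : Ideal D).IsPrincipal

/-- Every element `x` of the quotient field for which some nonzero `r ∈ R` has `r xⁿ ∈ R` for
all `n` lies in `R`. -/
def IsCompletelyIntegrallyClosed (R : Type*) [CommRing R] [IsDomain R] : Prop :=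
  ∀ x : FractionRing R, IsAlmostIntegral R x → x ∈ (algebraMap R (FractionRing R)).range

namespace StarOp

section

theorem mul_ne_zero' {D : Type*} [CommRing D] {K : Type*} [Field K]
    [Algebra D K] {I J : FractionalIdeal D⁰ K}
    (hI : I ≠ 0) (hJ : J ≠ 0) : I * J ≠ 0 := by
  intro h
  obtain ⟨x, hx, hx0⟩ : ∃ x ∈ I, x ≠ 0 := by
    by_contra! hc
    exact hI (FractionalIdeal.eq_zero_iff.2 hc)
  obtain ⟨y, hy, hy0⟩ : ∃ y ∈ J, y ≠ 0 := by
    by_contra! hc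
    exact hJ (FractionalIdeal.eq_zero_iff.2 hc)
  exact mul_ne_zero hx0 hy0 (FractionalIdeal.eq_zero_iff.1 h _ (FractionalIdeal.mul_mem_mul hx hy))

variable {D : Type*} [CommRing D] [IsDomain D] {K : Type*} [Field K] [Algebra D K]
  [IsFractionRing D K]

/-- The `v`-closure `(I⁻¹)⁻¹`, where `I⁻¹ = (D :_K I)` for nonzero `I`. -/
noncomputable def vClosure (I : FractionalIdeal D⁰ K) : FractionalIdeal D⁰ K := (I⁻¹)⁻¹

theorem vClosure_zero : vClosure (0 : FractionalIdeal D⁰ K) = 0 := by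
  simp [vClosure, FractionalIdeal.inv_eq]

theorem inv_ne_zero' {I : FractionalIdeal D⁰ K} (hI : I ≠ 0) : I⁻¹ ≠ 0 := by
  obtain ⟨a, J, ha, hJ⟩ := FractionalIdeal.exists_eq_spanSingleton_mul I
  intro h
  have hmem : algebraMap D K a ∈ I⁻¹ := by
    rw [FractionalIdeal.mem_inv_iff hI]
    intro y hy
    rw [hJ, FractionalIdeal.mem_singleton_mul] at hy
    obtain ⟨z, hz, rfl⟩ := hy
    have hne : algebraMap D K a ≠ 0 := by
      simpa using ha
    rw [mul_inv_cancel_left₀ hne]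
    exact FractionalIdeal.coeIdeal_le_one hz
  rw [h, FractionalIdeal.mem_zero_iff] at hmem
  exact ha (by simpa using hmem)

theorem mul_inv_le_one (I : FractionalIdeal D⁰ K) : I * I⁻¹ ≤ 1 := by
  rw [FractionalIdeal.inv_eq]; exact FractionalIdeal.mul_one_div_le_one

theorem le_vClosure (I : FractionalIdeal D⁰ K) : I ≤ vClosure I := by
  by_cases hI : I = 0
  · rw [hI, vClosure_zero]
  intro x hx
  rw [vClosure, FractionalIdeal.mem_inv_iff (inv_ne_zero' hI)]
  intro y hy
  exact mul_inv_le_one I (FractionalIdeal.mul_mem_mul hx hy)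

theorem vClosure_mono {I J : FractionalIdeal D⁰ K} (h : I ≤ J) : vClosure I ≤ vClosure J := by
  by_cases hI : I = 0
  · rw [hI, vClosure_zero]; exact bot_le
  have hJ : J ≠ 0 := fun hJ => hI (le_antisymm (hJ ▸ h) bot_le)
  exact FractionalIdeal.inv_anti_mono (inv_ne_zero' hJ) (inv_ne_zero' hI)
    (FractionalIdeal.inv_anti_mono hI hJ h)

theorem vClosure_inv (I : FractionalIdeal D⁰ K) : vClosure I⁻¹ = I⁻¹ := by
  by_cases hI : I = 0
  · simp [hI, vClosure, FractionalIdeal.inv_eq]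
  · exact le_antisymm (FractionalIdeal.inv_anti_mono hI
      (inv_ne_zero' (inv_ne_zero' hI)) (le_vClosure I)) (le_vClosure _)

theorem mul_vClosure_le (I J : FractionalIdeal D⁰ K) : I * vClosure J ≤ vClosure (I * J) := by
  by_cases hI : I = 0
  · simp [hI, vClosure_zero]
  by_cases hJ : J = 0
  · simp [hJ, vClosure_zero]
  rw [FractionalIdeal.mul_le]
  intro x hx y hy
  rw [vClosure, FractionalIdeal.mem_inv_iff (inv_ne_zero' (mul_ne_zero' hI hJ))]
  intro z hz
  rw [vClosure, FractionalIdeal.mem_inv_iff (inv_ne_zero' hJ)] at hy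
  rw [show x * y * z = y * (z * x) by ring]
  refine hy _ ?_
  rw [FractionalIdeal.mem_inv_iff hJ]
  intro w hw
  rw [mul_assoc]
  exact (FractionalIdeal.mem_inv_iff (mul_ne_zero' hI hJ)).1 hz _
    (FractionalIdeal.mul_mem_mul hx hw)

/-- The union of the `J_v` over the finitely generated fractional ideals `J ⊆ I`, as a
submodule of `K`. (Allowing `J = 0` only contributes the element `0`.) -/
def tSubmodule (I : FractionalIdeal D⁰ K) : Submodule D K where
  carrier := {x | ∃ J : FractionalIdeal D⁰ K,
    (J : Submodule D K).FG ∧ J ≤ I ∧ x ∈ vClosure J}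
  zero_mem' := ⟨0, by simpa using Submodule.fg_bot, bot_le, by
    rw [vClosure_zero]; exact (0 : FractionalIdeal D⁰ K).zero_mem⟩
  add_mem' := by
    rintro x y ⟨J, hJ, hJI, hx⟩ ⟨L, hL, hLI, hy⟩
    refine ⟨J ⊔ L, ?_, sup_le hJI hLI, ?_⟩
    · rw [FractionalIdeal.coe_sup]; exact hJ.sup hL
    · exact (vClosure (J ⊔ L) : Submodule D K).add_mem
        (vClosure_mono (le_sup_left : J ≤ J ⊔ L) hx)
        (vClosure_mono (le_sup_right : L ≤ J ⊔ L) hy)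
  smul_mem' := by
    rintro c x ⟨J, hJ, hJI, hx⟩
    exact ⟨J, hJ, hJI, Submodule.smul_mem (vClosure J : Submodule D K) c hx⟩

theorem mem_tSubmodule {I : FractionalIdeal D⁰ K} {x : K} :
    x ∈ tSubmodule I ↔ ∃ J : FractionalIdeal D⁰ K,
      (J : Submodule D K).FG ∧ J ≤ I ∧ x ∈ vClosure J := Iff.rfl

theorem tSubmodule_le (I : FractionalIdeal D⁰ K) :
    tSubmodule I ≤ (vClosure I : Submodule D K) := by
  intro x hx
  obtain ⟨J, -, hJI, hx⟩ := mem_tSubmodule.1 hx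
  exact vClosure_mono hJI hx

/-- The `t`-closure of a fractional ideal. -/
def tClosure (I : FractionalIdeal D⁰ K) : FractionalIdeal D⁰ K :=
  ⟨tSubmodule I, FractionalIdeal.isFractional_of_le (tSubmodule_le I)⟩

theorem mem_tClosure {I : FractionalIdeal D⁰ K} {x : K} :
    x ∈ tClosure I ↔ ∃ J : FractionalIdeal D⁰ K,
      (J : Submodule D K).FG ∧ J ≤ I ∧ x ∈ vClosure J := Iff.rfl

theorem tClosure_le_vClosure (I : FractionalIdeal D⁰ K) : tClosure I ≤ vClosure I := by
  intro x hx
  obtain ⟨J, -, hJI, hx⟩ := mem_tClosure.1 hx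
  exact vClosure_mono hJI hx

theorem le_tClosure (I : FractionalIdeal D⁰ K) : I ≤ tClosure I := by
  intro x hx
  refine mem_tClosure.2 ⟨FractionalIdeal.spanSingleton D⁰ x, ?_, ?_, le_vClosure _ ?_⟩
  · rw [FractionalIdeal.coe_spanSingleton]; exact Submodule.fg_span_singleton x
  · rwa [FractionalIdeal.spanSingleton_le_iff_mem]
  · exact FractionalIdeal.mem_spanSingleton_self D⁰ x

theorem tClosure_mono {I J : FractionalIdeal D⁰ K} (h : I ≤ J) : tClosure I ≤ tClosure J := by
  intro x hx
  obtain ⟨L, hL, hLI, hx⟩ := mem_tClosure.1 hx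
  exact mem_tClosure.2 ⟨L, hL, hLI.trans h, hx⟩

theorem exists_fg_of_fg_le_tClosure {I J : FractionalIdeal D⁰ K} (hJ : (J : Submodule D K).FG)
    (h : J ≤ tClosure I) :
    ∃ L : FractionalIdeal D⁰ K, (L : Submodule D K).FG ∧ L ≤ I ∧ J ≤ vClosure L := by
  classical
  obtain ⟨S, hS⟩ := hJ
  have key : ∀ T : Finset K, (∀ x ∈ T, x ∈ tClosure I) →
      ∃ L : FractionalIdeal D⁰ K, (L : Submodule D K).FG ∧ L ≤ I ∧ ∀ x ∈ T, x ∈ vClosure L := by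
    intro T
    induction T using Finset.induction_on with
    | empty => exact fun _ => ⟨0, by simpa using Submodule.fg_bot, bot_le, by simp⟩
    | insert a T _ ih =>
      intro hT
      obtain ⟨L, hL, hLI, hx⟩ := ih fun x hx => hT x (Finset.mem_insert_of_mem hx)
      obtain ⟨M, hM, hMI, ha⟩ := mem_tClosure.1 (hT a (Finset.mem_insert_self a T))
      refine ⟨L ⊔ M, ?_, sup_le hLI hMI, ?_⟩
      · rw [FractionalIdeal.coe_sup]; exact hL.sup hM
      · intro x hxT
        rcases Finset.mem_insert.1 hxT with rfl | hxT
        · exact vClosure_mono (le_sup_right : M ≤ L ⊔ M) ha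
        · exact vClosure_mono (le_sup_left : L ≤ L ⊔ M) (hx x hxT)
  obtain ⟨L, hL, hLI, hx⟩ := key S fun x hx => h (by
    have : x ∈ (J : Submodule D K) := hS ▸ Submodule.subset_span hx
    exact this)
  refine ⟨L, hL, hLI, ?_⟩
  rw [← FractionalIdeal.coe_le_coe, ← hS, Submodule.span_le]
  exact hx

theorem vClosure_vClosure (I : FractionalIdeal D⁰ K) : vClosure (vClosure I) = vClosure I :=
  vClosure_inv _

theorem tClosure_tClosure (I : FractionalIdeal D⁰ K) : tClosure (tClosure I) = tClosure I := by
  refine le_antisymm ?_ (le_tClosure _)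
  intro x hx
  obtain ⟨J, hJ, hJI, hx⟩ := mem_tClosure.1 hx
  obtain ⟨L, hL, hLI, hJL⟩ := exists_fg_of_fg_le_tClosure hJ hJI
  exact mem_tClosure.2 ⟨L, hL, hLI, vClosure_vClosure L ▸ vClosure_mono hJL hx⟩

theorem mul_tClosure_le (I J : FractionalIdeal D⁰ K) : I * tClosure J ≤ tClosure (I * J) := by
  rw [FractionalIdeal.mul_le]
  intro x hx y hy
  obtain ⟨L, hL, hLJ, hy⟩ := mem_tClosure.1 hy
  refine mem_tClosure.2 ⟨FractionalIdeal.spanSingleton D⁰ x * L, ?_, ?_, mul_vClosure_le _ _ ?_⟩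
  · rw [FractionalIdeal.coe_mul, FractionalIdeal.coe_spanSingleton]
    exact (Submodule.fg_span_singleton x).mul hL
  · exact mul_le_mul' (by rwa [FractionalIdeal.spanSingleton_le_iff_mem]) hLJ
  · exact FractionalIdeal.mul_mem_mul (FractionalIdeal.mem_spanSingleton_self D⁰ x) hy

theorem tClosure_mul_right (I J : FractionalIdeal D⁰ K) :
    tClosure (I * tClosure J) = tClosure (I * J) :=
  le_antisymm (tClosure_tClosure (I * J) ▸ tClosure_mono (mul_tClosure_le I J))
    (tClosure_mono (mul_le_mul' le_rfl (le_tClosure J)))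

theorem tClosure_mul_left (I J : FractionalIdeal D⁰ K) :
    tClosure (tClosure I * J) = tClosure (I * J) := by
  rw [mul_comm, tClosure_mul_right, mul_comm]

theorem tClosure_inv (I : FractionalIdeal D⁰ K) : tClosure I⁻¹ = I⁻¹ :=
  le_antisymm ((tClosure_le_vClosure _).trans (vClosure_inv I).le) (le_tClosure _)

theorem tClosure_spanSingleton (x : K) :
    tClosure (FractionalIdeal.spanSingleton D⁰ x) = FractionalIdeal.spanSingleton D⁰ x := by
  have h := tClosure_inv (FractionalIdeal.spanSingleton D⁰ x⁻¹)
  rwa [FractionalIdeal.spanSingleton_inv, inv_inv] at h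

theorem tClosure_one : tClosure (1 : FractionalIdeal D⁰ K) = 1 := by
  rw [← FractionalIdeal.spanSingleton_one, tClosure_spanSingleton]

/-- `I` is `t`-invertible: `(I I⁻¹)_t = D`. -/
def IsTInvertible (I : FractionalIdeal D⁰ K) : Prop := tClosure (I * I⁻¹) = 1

theorem IsTInvertible.of_mul {I J : FractionalIdeal D⁰ K} (hI : I ≠ 0)
    (h : tClosure (I * J) = 1) : IsTInvertible I := by
  have hJ : J ≤ I⁻¹ := by
    rw [FractionalIdeal.inv_eq, FractionalIdeal.le_div_iff_mul_le hI, mul_comm]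
    exact h ▸ le_tClosure _
  refine le_antisymm ?_ ?_
  · exact (tClosure_mono (mul_inv_le_one I)).trans tClosure_one.le
  · rw [← h]; exact tClosure_mono (mul_le_mul' le_rfl hJ)

end

section

variable (D : Type*) [CommRing D] [IsDomain D] (K : Type*) [Field K] [Algebra D K]
  [IsFractionRing D K]

/-- The `t`-invertible fractional `t`-ideals of `D`. -/
def TInv : Type _ :=
  {I : FractionalIdeal D⁰ K // I ≠ 0 ∧ tClosure I = I ∧ IsTInvertible I}

variable {D K}

/-- The `t`-multiplication `I * J = (I J)_t`. -/
noncomputable instance : Mul (TInv D K) :=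
  ⟨fun I J => ⟨tClosure (I.1 * J.1), by
    have h0 : tClosure (I.1 * J.1) ≠ 0 := fun h =>
      mul_ne_zero' I.2.1 J.2.1
        (le_antisymm ((le_tClosure (I.1 * J.1)).trans h.le) bot_le)
    refine ⟨h0, tClosure_tClosure _, .of_mul (J := I.1⁻¹ * J.1⁻¹) h0 ?_⟩
    rw [tClosure_mul_left, mul_mul_mul_comm, ← tClosure_mul_left, I.2.2.2, one_mul]
    exact J.2.2.2⟩⟩

noncomputable instance : One (TInv D K) :=
  ⟨⟨1, one_ne_zero, tClosure_one, .of_mul (J := 1) one_ne_zero (by rw [one_mul, tClosure_one])⟩⟩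

noncomputable instance : Inv (TInv D K) :=
  ⟨fun I => ⟨I.1⁻¹, inv_ne_zero' I.2.1, tClosure_inv _,
    .of_mul (J := I.1) (inv_ne_zero' I.2.1) (by rw [mul_comm]; exact I.2.2.2)⟩⟩

theorem TInv.mul_val (I J : TInv D K) : (I * J).1 = tClosure (I.1 * J.1) := rfl

theorem TInv.one_val : (1 : TInv D K).1 = 1 := rfl

theorem TInv.inv_val (I : TInv D K) : (I⁻¹).1 = I.1⁻¹ := rfl

noncomputable instance : CommGroup (TInv D K) where
  mul_assoc I J L := Subtype.ext <| by
    simp only [TInv.mul_val, tClosure_mul_left, tClosure_mul_right, mul_assoc]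
  one_mul I := Subtype.ext <| by rw [TInv.mul_val, TInv.one_val, one_mul, I.2.2.1]
  mul_one I := Subtype.ext <| by rw [TInv.mul_val, TInv.one_val, mul_one, I.2.2.1]
  inv_mul_cancel I := Subtype.ext <| by
    rw [TInv.mul_val, TInv.one_val, TInv.inv_val, mul_comm]; exact I.2.2.2
  mul_comm I J := Subtype.ext <| by rw [TInv.mul_val, TInv.mul_val, mul_comm]

variable (D K)

/-- The subgroup of nonzero principal fractional ideals. -/
noncomputable def principalSubgroup : Subgroup (TInv D K) where
  carrier := {I | ∃ x : K, x ≠ 0 ∧ I.1 = FractionalIdeal.spanSingleton D⁰ x}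
  one_mem' := ⟨1, one_ne_zero, by rw [TInv.one_val, FractionalIdeal.spanSingleton_one]⟩
  mul_mem' := by
    rintro I J ⟨x, hx, hI⟩ ⟨y, hy, hJ⟩
    refine ⟨x * y, mul_ne_zero hx hy, ?_⟩
    rw [TInv.mul_val, hI, hJ, FractionalIdeal.spanSingleton_mul_spanSingleton,
      tClosure_spanSingleton]
  inv_mem' := by
    rintro I ⟨x, hx, hI⟩
    exact ⟨x⁻¹, inv_ne_zero hx, by rw [TInv.inv_val, hI, FractionalIdeal.spanSingleton_inv]⟩

/-- The `t`-class group `Cl_t(D)`. -/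
abbrev TClassGroup : Type _ := TInv D K ⧸ principalSubgroup D K

end

/-- Prüfer `v`-multiplication domains: every nonzero finitely generated fractional ideal is
`t`-invertible. -/
def IsPVMD (D : Type*) [CommRing D] [IsDomain D] : Prop :=
  ∀ I : FractionalIdeal D⁰ (FractionRing D), I ≠ 0 →
    (I : Submodule D (FractionRing D)).FG → IsTInvertible I

end StarOp

/-! ### Almost integral elements and Laurent series -/

section AlmostIntegral

open scoped LaurentSeries PowerSeries

/-! For 3 → 2, work in `K⸨X⸩`, which contains the quotient field of `D⟦X⟧`: the leading coefficient
of an almost integral Laurent series is almost integral over `D`, so its coefficients fall into `D`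
one after another.

For 1 → 3, let `bⁿ ∣ r aⁿ` for all `n`. The AGCD property replaces `a ^ m / b ^ m` by a fraction `t
/ s` with `s` cancellable against `t`, so every power of `s` divides `r`. The root of `Y² - sY + X`
without constant term has Catalan coefficients over powers of `s`, so `r` times it lies in `D⟦X⟧`.
Integral closedness puts the root itself in `D⟦X⟧`, and its `X`-coefficient `1/s` makes `s` a unit
(`isUnit_of_forall_pow_dvd_of_isIntegrallyClosed_powerSeries`).

For 3 → 4, over an integrally closed AGCD domain every nonzero finitely generated `I` has some
`(Iⁿ)_v` principal (`exists_vClosure_pow_eq_spanSingleton`). This gives `t`-invertibility of `I`,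
and torsion because a `t`-invertible `t`-ideal is the `t`-closure of a finitely generated one. -/

theorem LaurentSeries.algebraMap_powerSeries_coeff {D : Type*} [CommRing D] {K : Type*} [Field K]
    [Algebra D K] (p : D⟦X⟧) (m : ℤ) :
    (algebraMap D⟦X⟧ K⸨X⸩ p).coeff m =
      if m < 0 then 0 else algebraMap D K (PowerSeries.coeff m.natAbs p) := by
  exact PowerSeries.coeff_coe (PowerSeries.map (algebraMap D K) p) m

theorem LaurentSeries.mem_range_algebraMap_powerSeries {D : Type*} [CommRing D] {K : Type*} [Field K]
    [Algebra D K] {f : K⸨X⸩} :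
    f ∈ (algebraMap D⟦X⟧ K⸨X⸩).range ↔
      ∀ m : ℤ, f.coeff m ∈ (algebraMap D K).range ∧ (m < 0 → f.coeff m = 0) := by
  constructor
  · rintro ⟨p, rfl⟩ m
    rw [algebraMap_powerSeries_coeff]
    split_ifs with h
    · exact ⟨zero_mem _, fun _ => rfl⟩
    · exact ⟨⟨_, rfl⟩, fun h' => absurd h' h⟩
  · intro h
    choose c hc using fun m => (h m).1
    refine ⟨PowerSeries.mk fun n => c n, ?_⟩
    ext m
    rw [algebraMap_powerSeries_coeff]
    split_ifs with hm
    · exact ((h m).2 hm).symm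
    · rw [PowerSeries.coeff_mk, hc]
      congr 1
      omega

variable {D : Type*} [CommRing D] [IsDomain D]

theorem IsCompletelyIntegrallyClosed.isIntegrallyClosed
    (h : IsCompletelyIntegrallyClosed D) : IsIntegrallyClosed D :=
  (isIntegrallyClosed_iff (FractionRing D)).2 fun hx => h _ hx.isAlmostIntegral

/-- Clear the denominator of `x = a / b`. The divisibility form makes no reference to a quotient
field, so for `D⟦X⟧` it can be tested inside `K⸨X⸩`. -/
theorem IsCompletelyIntegrallyClosed.of_forall_dvd
    (h : ∀ a b r : D, a ≠ 0 → b ≠ 0 → r ≠ 0 → (∀ n, b ^ n ∣ r * a ^ n) → b ∣ a) :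
    IsCompletelyIntegrallyClosed D := by
  intro x hx
  obtain ⟨r, hr, hx⟩ := hx
  obtain ⟨a, b, hb, rfl⟩ := IsFractionRing.div_surjective (A := D) x
  have hb0 : b ≠ 0 := nonZeroDivisors.ne_zero hb
  have hb1 : algebraMap D (FractionRing D) b ≠ 0 := by simpa using hb0
  by_cases ha : a = 0
  · exact ⟨0, by simp [ha]⟩
  obtain ⟨c, hc⟩ := h a b r ha hb0 (nonZeroDivisors.ne_zero hr) fun n => by
    obtain ⟨y, hy⟩ := hx n
    refine ⟨y, IsFractionRing.injective D (FractionRing D) ?_⟩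
    rw [map_mul, map_mul, hy, Algebra.smul_def, map_pow, map_pow, div_pow, mul_left_comm,
      mul_div_cancel₀ _ (pow_ne_zero n hb1)]
  exact ⟨c, by rw [hc, map_mul, mul_div_cancel_left₀ _ hb1]⟩

variable {K : Type*} [Field K] [Algebra D K] [IsFractionRing D K]

theorem LaurentSeries.algebraMap_powerSeries_injective :
    Function.Injective (algebraMap D⟦X⟧ K⸨X⸩) := by
  intro p q h
  ext n
  apply IsFractionRing.injective D K
  simpa [algebraMap_powerSeries_coeff, (Int.natCast_nonneg n).not_gt] using congrArg (HahnSeries.coeff · (n : ℤ)) h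

theorem IsAlmostIntegral.laurentSeries_order_nonneg {f : K⸨X⸩} (hf : IsAlmostIntegral D⟦X⟧ f)
    (hf0 : f ≠ 0) : 0 ≤ f.order := by
  obtain ⟨g, hg, h⟩ := hf
  have hg0 : algebraMap D⟦X⟧ K⸨X⸩ g ≠ 0 := by
    rw [Ne, map_eq_zero_iff _ LaurentSeries.algebraMap_powerSeries_injective]
    exact nonZeroDivisors.ne_zero hg
  by_contra! hlt
  have key : ∀ n : ℕ, 0 ≤ (algebraMap D⟦X⟧ K⸨X⸩ g).order + n * f.order := by
    intro n
    have h0 : g • f ^ n ≠ 0 := by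
      rw [Algebra.smul_def]; exact mul_ne_zero hg0 (pow_ne_zero _ hf0)
    have := (LaurentSeries.mem_range_algebraMap_powerSeries.1 (h n) (g • f ^ n).order).2
    rw [Algebra.smul_def] at this h0
    rw [HahnSeries.order_mul hg0 (pow_ne_zero _ hf0), HahnSeries.order_pow, nsmul_eq_mul] at this
    by_contra! hneg
    have h1 := this hneg
    rw [← nsmul_eq_mul, ← HahnSeries.order_pow,
      ← HahnSeries.order_mul hg0 (pow_ne_zero _ hf0)] at h1
    exact (HahnSeries.coeff_order_eq_zero.not.2 h0) h1
  -- With `f.order ≤ -1`, this exponent outweighs the order of `g`.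
  have := key ((algebraMap D⟦X⟧ K⸨X⸩ g).order.natAbs + 1)
  push_cast at this
  nlinarith [le_abs_self (algebraMap D⟦X⟧ K⸨X⸩ g).order,
    abs_nonneg (algebraMap D⟦X⟧ K⸨X⸩ g).order]

/-- Leading coefficients multiply over a field, so the leading coefficient of the multiplier `g`
serves as a multiplier in `D`. -/
theorem IsAlmostIntegral.laurentSeries_leadingCoeff {f : K⸨X⸩}
    (hf : IsAlmostIntegral D⟦X⟧ f) : IsAlmostIntegral D f.leadingCoeff := by
  obtain ⟨g, hg, h⟩ := hf
  have hinj := LaurentSeries.algebraMap_powerSeries_injective (D := D) (K := K)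
  have hg0 : algebraMap D⟦X⟧ K⸨X⸩ g ≠ 0 := by
    rw [Ne, map_eq_zero_iff _ hinj]
    exact nonZeroDivisors.ne_zero hg
  have hlead : ∀ {p : K⸨X⸩}, p ∈ (algebraMap D⟦X⟧ K⸨X⸩).range →
      p.leadingCoeff ∈ (algebraMap D K).range := fun {p} hp => by
    rw [HahnSeries.leadingCoeff_eq]
    exact (LaurentSeries.mem_range_algebraMap_powerSeries.1 hp _).1
  obtain ⟨r, hr⟩ := hlead ⟨g, rfl⟩
  refine ⟨r, mem_nonZeroDivisors_of_ne_zero ?_, fun n => ?_⟩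
  · rintro rfl
    rw [map_zero] at hr
    exact hg0 (HahnSeries.leadingCoeff_eq_zero.1 hr.symm)
  · have := hlead (h n)
    have hpow : ∀ n : ℕ, (f ^ n).leadingCoeff = f.leadingCoeff ^ n := fun n => by
      induction n with
      | zero => simp
      | succ k ih => rw [pow_succ, HahnSeries.leadingCoeff_mul, ih, pow_succ]
    rwa [Algebra.smul_def, HahnSeries.leadingCoeff_mul, hpow, ← hr, ← Algebra.smul_def] at this

theorem IsCompletelyIntegrallyClosed.mem_range_of_laurentSeries
    (hD : IsCompletelyIntegrallyClosed D) {f : (FractionRing D)⸨X⸩}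
    (hf : IsAlmostIntegral D⟦X⟧ f) : f ∈ (algebraMap D⟦X⟧ (FractionRing D)⸨X⸩).range := by
  have hneg : ∀ m : ℤ, m < 0 → f.coeff m = 0 := fun m hm => by
    by_cases hf0 : f = 0
    · simp [hf0]
    · exact HahnSeries.coeff_eq_zero_of_lt_order
        (hm.trans_le (hf.laurentSeries_order_nonneg hf0))
  suffices H : ∀ n : ℕ, f.coeff n ∈ (algebraMap D (FractionRing D)).range by
    refine LaurentSeries.mem_range_algebraMap_powerSeries.2 fun m => ⟨?_, hneg m⟩
    obtain hm | hm := lt_or_ge m 0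
    · rw [hneg m hm]; exact zero_mem _
    · lift m to ℕ using hm
      exact H m
  intro n
  induction n using Nat.strong_induction_on with | h n IH =>
  choose! c hc using IH
  -- The part of `f` below degree `n` is already over `D`; subtracting it keeps almost integrality
  -- and makes the `n`-th coefficient leading, unless it vanishes.
  set p : D⟦X⟧ := PowerSeries.mk fun i => if i < n then c i else 0 with hp
  set g := f - algebraMap D⟦X⟧ (FractionRing D)⸨X⸩ p with hg
  have hgint : IsAlmostIntegral D⟦X⟧ g :=
    (completeIntegralClosure D⟦X⟧ (FractionRing D)⸨X⸩).sub_mem hf (algebraMap_mem _ p)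
  have hlow : ∀ m : ℤ, m < n → g.coeff m = 0 := fun m hm => by
    rw [hg, HahnSeries.coeff_sub, LaurentSeries.algebraMap_powerSeries_coeff]
    split_ifs with h0
    · rw [hneg m h0, sub_zero]
    · lift m to ℕ using not_lt.1 h0
      have hm' : m < n := by exact_mod_cast hm
      simp [hp, hm', hc m hm']
  have hgn : g.coeff n = f.coeff n := by
    rw [hg, HahnSeries.coeff_sub, LaurentSeries.algebraMap_powerSeries_coeff]
    simp [hp]
  by_cases h0 : f.coeff n = 0
  · rw [h0]; exact zero_mem _
  have hord : g.order = n := by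
    apply le_antisymm
    · exact HahnSeries.order_le_of_coeff_ne_zero (hgn ▸ h0)
    · have hg0 : g ≠ 0 := fun h => h0 (by rw [← hgn, h]; simp)
      by_contra! hlt
      exact HahnSeries.coeff_order_eq_zero.not.2 hg0 (hlow _ hlt)
  have := hD _ hgint.laurentSeries_leadingCoeff
  rwa [HahnSeries.leadingCoeff_eq, hord, hgn] at this

theorem IsCompletelyIntegrallyClosed.powerSeries (hD : IsCompletelyIntegrallyClosed D) :
    IsCompletelyIntegrallyClosed D⟦X⟧ := by
  refine .of_forall_dvd fun p q g hp hq hg h => ?_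
  have hinj := LaurentSeries.algebraMap_powerSeries_injective (D := D) (K := FractionRing D)
  set ι := algebraMap D⟦X⟧ (FractionRing D)⸨X⸩
  have hq0 : ι q ≠ 0 := by rwa [Ne, map_eq_zero_iff _ hinj]
  obtain ⟨c, hc⟩ := hD.mem_range_of_laurentSeries (f := ι p / ι q)
    ⟨g, mem_nonZeroDivisors_of_ne_zero hg, fun n => by
      obtain ⟨s, hs⟩ := h n
      refine ⟨s, ?_⟩
      have := congrArg ι hs
      rw [map_mul, map_mul, map_pow, map_pow] at this
      rw [Algebra.smul_def, div_pow, mul_div_assoc', eq_div_iff (pow_ne_zero _ hq0), this,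
        mul_comm]⟩
  refine ⟨c, hinj ?_⟩
  rw [eq_div_iff hq0] at hc
  rw [← hc, map_mul, mul_comm]

end AlmostIntegral

/-! ### Catalan series, and complete integral closedness of `D` from `D⟦X⟧` -/

section Catalan

open scoped PowerSeries

variable {D : Type*} [CommRing D] [IsDomain D]

/-- Rescale the Catalan equation `S = 1 + X S²` by `X ↦ X / β²` and put `c = β⁻¹ S(X / β²)`. -/
theorem PowerSeries.exists_catalan_root (K : Type*) [Field K] {β : K} (hβ : β ≠ 0) :
    ∃ c : K⟦X⟧, (∀ n, coeff n c = β⁻¹ ^ (2 * n + 1) * catalan n) ∧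
      (X * c) ^ 2 - C β * (X * c) + X = 0 := by
  set c₀ : K⟦X⟧ := rescale (β⁻¹ ^ 2) (map (Nat.castRingHom K) catalanSeries) with hc₀
  have hc : c₀ ^ 2 * (C (β⁻¹ ^ 2) * X) + 1 = c₀ := by
    have := congrArg (fun s => rescale (β⁻¹ ^ 2) (map (Nat.castRingHom K) s))
      catalanSeries_sq_mul_X_add_one
    simpa only [map_add, map_mul, map_pow, map_one, map_X, rescale_X, ← hc₀] using this
  refine ⟨C β⁻¹ * c₀, fun n => ?_, ?_⟩
  · rw [coeff_C_mul, hc₀, coeff_rescale, coeff_map, catalanSeries_coeff, eq_natCast]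
    ring
  · have hββ : (C β : K⟦X⟧) * C β⁻¹ = 1 := by
      rw [← map_mul, mul_inv_cancel₀ hβ, map_one]
    rw [map_pow] at hc
    linear_combination (X : K⟦X⟧) * hc - X * c₀ * hββ

/-- If `bⁿ ∣ r` for all `n`, then `r` times a root of `Y² - b Y + X` is a power series over `D`. -/
theorem PowerSeries.exists_mul_root_of_forall_pow_dvd {b r : D} (hr : r ≠ 0)
    (h : ∀ n, b ^ n ∣ r) :
    ∃ G : D⟦X⟧, b * coeff 1 G = r ∧ G ^ 2 - C b * C r * G + C r ^ 2 * X = 0 := by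
  have hb : b ≠ 0 := by rintro rfl; exact hr (by simpa using h 1)
  have hbK : algebraMap D (FractionRing D) b ≠ 0 := by simpa using hb
  obtain ⟨c, hc, hroot⟩ := exists_catalan_root (FractionRing D) hbK
  choose s hs using h
  have hsK : ∀ n, algebraMap D (FractionRing D) (s n) =
      algebraMap D (FractionRing D) r * (algebraMap D (FractionRing D) b)⁻¹ ^ n := fun n => by
    rw [inv_pow, eq_mul_inv_iff_mul_eq₀ (pow_ne_zero n hbK), ← map_pow, ← map_mul, mul_comm,
      ← hs n]
  -- Here `s k` is `r / b ^ k`, so `p` is `r` times the Catalan series `c`.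
  set p : D⟦X⟧ := mk fun n => s (2 * n + 1) * (catalan n : D) with hp
  have hpc : map (algebraMap D (FractionRing D)) p = C (algebraMap D (FractionRing D) r) * c := by
    ext n
    rw [coeff_map, hp, coeff_mk, coeff_C_mul, hc, map_mul, hsK, map_natCast, mul_assoc]
  refine ⟨X * p, ?_, map_injective _ (IsFractionRing.injective D (FractionRing D)) ?_⟩
  · have : coeff (0 + 1) (X * p) = s 1 := by
      rw [coeff_succ_X_mul, hp, coeff_mk]
      simp
    rw [← zero_add 1, this]
    simpa using (hs 1).symm
  · simp only [map_add, map_sub, map_mul, map_pow, map_C, hpc, map_X, map_zero]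
    linear_combination C (algebraMap D (FractionRing D) r) ^ 2 * hroot

/-- `G / r` is a root of the monic `Y² - bY + X`, hence a power series `u`; comparing
`X`-coefficients in `u r = G` shows that `b` is inverse to that of `u`. -/
theorem isUnit_of_forall_pow_dvd_of_isIntegrallyClosed_powerSeries [IsIntegrallyClosed D⟦X⟧]
    {b r : D} (hr : r ≠ 0) (h : ∀ n, b ^ n ∣ r) : IsUnit b := by
  obtain ⟨G, hG1, hrel⟩ := PowerSeries.exists_mul_root_of_forall_pow_dvd hr h
  have hrF : algebraMap D⟦X⟧ (FractionRing D⟦X⟧) (PowerSeries.C r) ≠ 0 := by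
    simpa [map_eq_zero_iff _ PowerSeries.C_injective] using hr
  set y := algebraMap D⟦X⟧ (FractionRing D⟦X⟧) G /
    algebraMap D⟦X⟧ (FractionRing D⟦X⟧) (PowerSeries.C r) with hy
  have hyG : y * algebraMap D⟦X⟧ (FractionRing D⟦X⟧) (PowerSeries.C r) =
      algebraMap D⟦X⟧ (FractionRing D⟦X⟧) G := div_mul_cancel₀ _ hrF
  obtain ⟨u, hu⟩ := IsIntegrallyClosed.isIntegral_iff.1 (show IsIntegral D⟦X⟧ y from by
      refine ⟨Polynomial.X ^ 2 + (- Polynomial.C (PowerSeries.C b) * Polynomial.X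
        + Polynomial.C PowerSeries.X), ?_, ?_⟩
      · apply Polynomial.monic_X_pow_add
        compute_degree!
      · have := congrArg (algebraMap D⟦X⟧ (FractionRing D⟦X⟧)) hrel
        simp only [map_add, map_sub, map_mul, map_pow, map_zero, ← hyG] at this
        simp only [Polynomial.eval₂_add, Polynomial.eval₂_mul, Polynomial.eval₂_neg,
          Polynomial.eval₂_pow, Polynomial.eval₂_X, Polynomial.eval₂_C]
        refine (mul_eq_zero.1 ?_).resolve_left (pow_ne_zero 2 hrF)
        linear_combination this)
  rw [← hu, ← map_mul] at hyG
  have h1 := congrArg (PowerSeries.coeff 1) (IsFractionRing.injective D⟦X⟧ (FractionRing D⟦X⟧) hyG)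
  rw [PowerSeries.coeff_mul_C] at h1
  refine IsUnit.of_mul_eq_one (PowerSeries.coeff 1 u) (mul_right_cancel₀ hr ?_)
  rw [mul_assoc, h1, hG1, one_mul]

theorem dvd_of_pow_dvd_pow_of_isIntegrallyClosed_powerSeries [IsIntegrallyClosed D⟦X⟧]
    {a b : D} {m : ℕ} (hm : m ≠ 0) (h : b ^ m ∣ a ^ m) : b ∣ a := by
  have : (PowerSeries.C b : D⟦X⟧) ∣ PowerSeries.C a := by
    rw [← IsIntegrallyClosed.pow_dvd_pow_iff hm, ← map_pow, ← map_pow]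
    exact map_dvd _ h
  obtain ⟨c, hc⟩ := this
  exact ⟨PowerSeries.coeff 0 c, by simpa using congrArg (PowerSeries.coeff 0) hc⟩

/-- Take `a s = b t` to be the generator. If `t c = s u` then `a c = b u` is a common multiple,
hence divisible by `a s`. -/
theorem exists_mul_eq_mul_forall_dvd_of_isPrincipal {a b : D} (ha : a ≠ 0) (hb : b ≠ 0)
    (h : (Ideal.span {a} ⊓ Ideal.span {b} : Ideal D).IsPrincipal) :
    ∃ s t : D, a * s = b * t ∧ s ≠ 0 ∧ ∀ c, s ∣ t * c → s ∣ c := by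
  obtain ⟨l, hl⟩ := h
  rw [Ideal.submodule_span_eq] at hl
  have hl1 : l ∈ Ideal.span {a} ⊓ Ideal.span {b} := hl ▸ Ideal.mem_span_singleton_self l
  obtain ⟨⟨s, hs⟩, ⟨t, ht⟩⟩ := (Ideal.mem_inf.1 hl1).imp
    Ideal.mem_span_singleton.1 Ideal.mem_span_singleton.1
  have hs0 : s ≠ 0 := by
    rintro rfl
    rw [mul_zero] at hs
    have : a * b ∈ Ideal.span {l} := hl ▸ Ideal.mem_inf.2
      ⟨Ideal.mem_span_singleton.2 (dvd_mul_right _ _),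
        Ideal.mem_span_singleton.2 (dvd_mul_left _ _)⟩
    rw [Ideal.mem_span_singleton, hs, zero_dvd_iff] at this
    exact mul_ne_zero ha hb this
  refine ⟨s, t, hs ▸ ht, hs0, fun c ⟨u, hu⟩ => ?_⟩
  have hst : a * s = b * t := hs ▸ ht
  have hbu : a * c = b * u := mul_left_cancel₀ hs0 (by linear_combination c * hst + b * hu)
  have : a * c ∈ Ideal.span {l} := hl ▸ Ideal.mem_inf.2
    ⟨Ideal.mem_span_singleton.2 (dvd_mul_right _ _),
      Ideal.mem_span_singleton.2 (hbu ▸ dvd_mul_right _ _)⟩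
  obtain ⟨w, hw⟩ := Ideal.mem_span_singleton.1 this
  exact ⟨w, mul_left_cancel₀ ha (by rw [hw, hs, mul_assoc])⟩

theorem pow_dvd_of_pow_dvd_mul_pow {s t : D} (hs0 : s ≠ 0)
    (hst : ∀ c, s ∣ t * c → s ∣ c) (n k : ℕ) (c : D) (h : s ^ n ∣ t ^ k * c) : s ^ n ∣ c := by
  have step : ∀ n c, s ^ n ∣ t * c → s ^ n ∣ c := by
    intro n
    induction n with
    | zero => simp
    | succ n ih =>
      intro c hc
      obtain ⟨d, rfl⟩ := hst c ((dvd_pow_self s n.succ_ne_zero).trans hc)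
      rw [pow_succ', mul_left_comm, mul_dvd_mul_iff_left hs0] at hc
      rw [pow_succ']
      exact mul_dvd_mul_left s (ih d hc)
  induction k with
  | zero => simpa using h
  | succ k ih => exact ih (step n _ (by rwa [pow_succ', mul_assoc] at h))

theorem IsAGCDDomain.isCompletelyIntegrallyClosed_of_powerSeries (hD : IsAGCDDomain D)
    [IsIntegrallyClosed D⟦X⟧] : IsCompletelyIntegrallyClosed D := by
  refine .of_forall_dvd fun a b r ha hb hr h => ?_
  obtain ⟨m, hm, hp⟩ := hD a b ha hb
  obtain ⟨s, t, hst, hs0, hcop⟩ := exists_mul_eq_mul_forall_dvd_of_isPrincipal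
    (pow_ne_zero m ha) (pow_ne_zero m hb) hp
  -- Raising `aᵐ s = bᵐ t` to the `n`-th power and using `b ^ (m n) ∣ r a ^ (m n)` gives `sⁿ ∣ tⁿ
  -- r`; then `tⁿ` cancels.
  have hunit : IsUnit s := isUnit_of_forall_pow_dvd_of_isIntegrallyClosed_powerSeries hr fun n => by
    refine pow_dvd_of_pow_dvd_mul_pow hs0 hcop n n r ?_
    obtain ⟨q, hq⟩ := h (m * n)
    refine ⟨q, mul_left_cancel₀ (pow_ne_zero n (pow_ne_zero m hb)) ?_⟩
    have := congrArg (· ^ n) hst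
    simp only [mul_pow, ← pow_mul] at this ⊢
    linear_combination s ^ n * hq - r * this
  refine dvd_of_pow_dvd_pow_of_isIntegrallyClosed_powerSeries (Nat.one_le_iff_ne_zero.1 hm) ?_
  rw [← hunit.dvd_mul_right, hst]
  exact dvd_mul_right _ _

end Catalan

/-! ### Principal powers of finitely generated ideals, `t`-invertibility and torsion -/

namespace StarOp

section

open FractionalIdeal

variable {D : Type*} [CommRing D] {K : Type*} [Field K] [Algebra D K]

theorem add_pow_le_of_forall_mul_le {I J S : FractionalIdeal D⁰ K} {N : ℕ}
    (h : ∀ i ≤ N, I ^ i * J ^ (N - i) ≤ S) : (I + J) ^ N ≤ S := by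
  rw [add_pow]
  refine Finset.sum_induction _ (· ≤ S) (fun a b ha hb => ?_) (zero_le _) fun i hi => ?_
  · rw [← sup_eq_add]; exact sup_le ha hb
  · rw [mul_comm, ← nsmul_eq_mul]
    -- Binomial coefficients are harmless: a multiple `k • A` is a repeated sum of ideals, so it
    -- stays below any bound for `A`.
    generalize N.choose i = k
    induction k with
    | zero => rw [zero_nsmul]; exact zero_le _
    | succ k ih =>
      rw [succ_nsmul, ← sup_eq_add]
      exact sup_le ih (h i (Nat.lt_succ_iff.1 (Finset.mem_range.1 hi)))

theorem pow_mem_pow {I : FractionalIdeal D⁰ K} {x : K} (hx : x ∈ I) (n : ℕ) : x ^ n ∈ I ^ n := by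
  induction n with
  | zero => rw [pow_zero, pow_zero]; exact one_mem_one D⁰
  | succ n ih => rw [pow_succ, pow_succ]; exact mul_mem_mul ih hx

theorem coe_pow_fg {I : FractionalIdeal D⁰ K} (h : (I : Submodule D K).FG) (n : ℕ) :
    ((I ^ n : FractionalIdeal D⁰ K) : Submodule D K).FG := by
  rw [coe_pow]; exact h.pow n

theorem exists_fg_le_mul {I M L : FractionalIdeal D⁰ K} (hL : (L : Submodule D K).FG)
    (h : L ≤ I * M) :
    ∃ J : FractionalIdeal D⁰ K, (J : Submodule D K).FG ∧ J ≤ I ∧ L ≤ J * M := by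
  classical
  obtain ⟨S, hS⟩ := hL
  have key : ∀ T : Finset K, (∀ x ∈ T, x ∈ I * M) →
      ∃ J : FractionalIdeal D⁰ K, (J : Submodule D K).FG ∧ J ≤ I ∧ ∀ x ∈ T, x ∈ J * M := by
    intro T
    induction T using Finset.induction_on with
    | empty => exact fun _ => ⟨0, by simpa using Submodule.fg_bot, zero_le _, by simp⟩
    | insert a T _ ih =>
      intro hT
      obtain ⟨J, hJ, hJI, hx⟩ := ih fun x hx => hT x (Finset.mem_insert_of_mem hx)
      obtain ⟨U, V, hU, hV, ha⟩ := FractionalIdeal.mem_span_mul_finite_of_mem_mul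
        (hT a (Finset.mem_insert_self a T))
      have hUI : Submodule.span D (U : Set K) ≤ (I : Submodule D K) := Submodule.span_le.2 hU
      obtain ⟨N, hN⟩ : ∃ N : FractionalIdeal D⁰ K, (N : Submodule D K) = Submodule.span D U :=
        ⟨⟨_, isFractional_of_le hUI⟩, rfl⟩
      refine ⟨J ⊔ N, ?_, sup_le hJI (coe_le_coe.1 (hN ▸ hUI)), fun x hxT => ?_⟩
      · rw [coe_sup, hN]; exact hJ.sup ⟨U, rfl⟩
      · rcases Finset.mem_insert.1 hxT with rfl | hxT
        · rw [← mem_coe, coe_mul, coe_sup, hN]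
          rw [← Submodule.span_mul_span] at ha
          exact mul_le_mul' (le_sup_right (a := (J : Submodule D K)))
            (Submodule.span_le.2 hV) ha
        · exact (mul_le_mul' le_sup_left le_rfl : J * M ≤ (J ⊔ N) * M) (hx x hxT)
  obtain ⟨J, hJ, hJI, hx⟩ := key S fun x hx => h (by
    have : x ∈ (L : Submodule D K) := hS ▸ Submodule.subset_span hx
    exact this)
  refine ⟨J, hJ, hJI, ?_⟩
  rw [← coe_le_coe, ← hS, Submodule.span_le]
  exact hx

variable [IsFractionRing D K]

theorem pow_le_of_le_spanSingleton {I : FractionalIdeal D⁰ K} {e : K}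
    (h : I ≤ spanSingleton D⁰ e) (n : ℕ) : I ^ n ≤ spanSingleton D⁰ (e ^ n) := by
  rw [← spanSingleton_pow]
  exact pow_le_pow_left' h n

theorem le_spanSingleton_of_forall_pow_mem [IsIntegrallyClosed D] {I : FractionalIdeal D⁰ K}
    {e : K} {n : ℕ} (hn : n ≠ 0) (he : e ≠ 0)
    (h : ∀ x ∈ I, x ^ n ∈ spanSingleton D⁰ (e ^ n)) : I ≤ spanSingleton D⁰ e := by
  intro x hx
  obtain ⟨d, hd⟩ := (mem_spanSingleton D⁰).1 (h x hx)
  obtain ⟨c, hc⟩ := IsIntegrallyClosed.exists_algebraMap_eq_of_isIntegral_pow (R := D)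
    (x := x / e) (Nat.pos_of_ne_zero hn) (by
      rw [div_pow, ← hd, Algebra.smul_def, mul_div_cancel_right₀ _ (pow_ne_zero n he)]
      exact isIntegral_algebraMap)
  exact (mem_spanSingleton D⁰).2 ⟨c, by rw [Algebra.smul_def, hc, div_mul_cancel₀ _ he]⟩

variable [IsDomain D]

theorem vClosure_spanSingleton (x : K) :
    vClosure (spanSingleton D⁰ x) = spanSingleton D⁰ x := by
  rw [vClosure, spanSingleton_inv, spanSingleton_inv, inv_inv]

theorem tClosure_eq_vClosure_of_fg {I : FractionalIdeal D⁰ K} (h : (I : Submodule D K).FG) :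
    tClosure I = vClosure I :=
  le_antisymm (tClosure_le_vClosure I) fun _ hx => mem_tClosure.2 ⟨I, h, le_rfl, hx⟩

theorem vClosure_add_right (I J : FractionalIdeal D⁰ K) :
    vClosure (I + vClosure J) = vClosure (I + J) := by
  simp only [← sup_eq_add]
  refine le_antisymm ?_ (vClosure_mono (sup_le_sup_left (le_vClosure J) I))
  rw [← vClosure_vClosure (I ⊔ J)]
  exact vClosure_mono (sup_le (le_sup_left.trans (le_vClosure _)) (vClosure_mono le_sup_right))

theorem vClosure_add_left (I J : FractionalIdeal D⁰ K) :
    vClosure (vClosure I + J) = vClosure (I + J) := by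
  rw [add_comm, vClosure_add_right, add_comm]

theorem vClosure_pow (I : FractionalIdeal D⁰ K) (n : ℕ) :
    vClosure (vClosure I ^ n) = vClosure (I ^ n) := by
  refine le_antisymm ?_ (vClosure_mono (pow_le_pow_left' (le_vClosure I) n))
  rw [← vClosure_vClosure (I ^ n)]
  refine vClosure_mono ?_
  induction n with
  | zero => rw [pow_zero, pow_zero]; exact le_vClosure _
  | succ n ih =>
    rw [pow_succ, pow_succ]
    calc vClosure I ^ n * vClosure I ≤ vClosure (I ^ n) * vClosure I := mul_le_mul' ih le_rfl
      _ ≤ vClosure (vClosure (I ^ n) * I) := mul_vClosure_le _ _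
      _ ≤ vClosure (vClosure (I ^ n * I)) := by
        refine vClosure_mono ?_
        rw [mul_comm, mul_comm (I ^ n)]
        exact mul_vClosure_le _ _
      _ = vClosure (I ^ n * I) := vClosure_vClosure _

/-- If `(a) ∩ (b) = (l)`, the inverse of `(a/c, b/c)` is generated by `c l / (a b)`: for `z` in that
inverse, `z a b / c` is a common multiple of `a` and `b`. -/
theorem vClosure_add_spanSingleton_of_isPrincipal {a b : D} (ha : a ≠ 0) (hb : b ≠ 0)
    (h : (Ideal.span {a} ⊓ Ideal.span {b} : Ideal D).IsPrincipal) (c : K) (hc : c ≠ 0) :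
    ∃ e : K, e ≠ 0 ∧ vClosure (spanSingleton D⁰ (algebraMap D K a / c) +
      spanSingleton D⁰ (algebraMap D K b / c)) = spanSingleton D⁰ e := by
  obtain ⟨l, hl⟩ := h
  rw [Ideal.submodule_span_eq] at hl
  have hmem : ∀ d : D, a ∣ d ∧ b ∣ d ↔ l ∣ d := fun d => by
    rw [← Ideal.mem_span_singleton, ← Ideal.mem_span_singleton, ← Ideal.mem_span_singleton, ← hl,
      Ideal.mem_inf]
  have hl0 : l ≠ 0 := by
    rintro rfl
    exact mul_ne_zero ha hb (zero_dvd_iff.1 ((hmem _).1 ⟨dvd_mul_right _ _, dvd_mul_left _ _⟩))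
  have hinj := IsFractionRing.injective D K
  have haK : algebraMap D K a ≠ 0 := by rwa [Ne, map_eq_zero_iff _ hinj]
  have hbK : algebraMap D K b ≠ 0 := by rwa [Ne, map_eq_zero_iff _ hinj]
  have hlK : algebraMap D K l ≠ 0 := by rwa [Ne, map_eq_zero_iff _ hinj]
  have hA0 : algebraMap D K a / c ≠ 0 := div_ne_zero haK hc
  set I := spanSingleton D⁰ (algebraMap D K a / c) + spanSingleton D⁰ (algebraMap D K b / c)
    with hI
  have hI0 : I ≠ 0 := by
    intro h0
    have : algebraMap D K a / c ∈ I := by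
      rw [hI, ← sup_eq_add]
      exact (le_sup_left : spanSingleton D⁰ (algebraMap D K a / c) ≤ _)
        (mem_spanSingleton_self D⁰ _)
    rw [h0, mem_zero_iff] at this
    exact hA0 this
  refine ⟨algebraMap D K a * algebraMap D K b / (c * algebraMap D K l),
    div_ne_zero (mul_ne_zero haK hbK) (mul_ne_zero hc hlK), ?_⟩
  suffices hinv : I⁻¹ =
      spanSingleton D⁰ (algebraMap D K a * algebraMap D K b / (c * algebraMap D K l))⁻¹ by
    rw [vClosure, hinv, spanSingleton_inv, inv_inv]
  ext z
  rw [mem_inv_iff hI0, mem_spanSingleton]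
  constructor
  · intro hz
    have hza : z * (algebraMap D K a / c) ∈ (1 : FractionalIdeal D⁰ K) := hz _ (by
      rw [hI, ← sup_eq_add]
      exact (le_sup_left : spanSingleton D⁰ (algebraMap D K a / c) ≤ _)
        (mem_spanSingleton_self D⁰ _))
    have hzb : z * (algebraMap D K b / c) ∈ (1 : FractionalIdeal D⁰ K) := hz _ (by
      rw [hI, ← sup_eq_add]
      exact (le_sup_right : spanSingleton D⁰ (algebraMap D K b / c) ≤ _)
        (mem_spanSingleton_self D⁰ _))
    obtain ⟨s, hs⟩ := (mem_one_iff D⁰).1 hza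
    obtain ⟨t, ht⟩ := (mem_one_iff D⁰).1 hzb
    have hst : b * s = a * t := hinj (by
      rw [map_mul, map_mul, hs, ht]
      ring)
    obtain ⟨w, hw⟩ := (hmem (b * s)).1 ⟨hst ▸ dvd_mul_right _ _, dvd_mul_right _ _⟩
    have hwK := congrArg (algebraMap D K) hw
    rw [map_mul, map_mul, hs] at hwK
    refine ⟨w, ?_⟩
    rw [Algebra.smul_def]
    field_simp at hwK ⊢
    linear_combination -hwK
  · rintro ⟨w, rfl⟩ y hy
    obtain ⟨⟨s, hs⟩, ⟨t, ht⟩⟩ := (hmem l).2 dvd_rfl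
    have hsK := congrArg (algebraMap D K) hs
    have htK := congrArg (algebraMap D K) ht
    rw [map_mul] at hsK htK
    rw [hI, ← sup_eq_add, ← mem_coe, coe_sup, Submodule.mem_sup] at hy
    obtain ⟨p, hp, q, hq, rfl⟩ := hy
    obtain ⟨u, rfl⟩ := (mem_spanSingleton D⁰).1 hp
    obtain ⟨v, rfl⟩ := (mem_spanSingleton D⁰).1 hq
    refine (mem_one_iff D⁰).2 ⟨w * (u * t + v * s), ?_⟩
    simp only [Algebra.smul_def, map_mul, map_add]
    have e1 : algebraMap D K t = algebraMap D K l / algebraMap D K b := by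
      rw [htK]; field_simp
    have e2 : algebraMap D K s = algebraMap D K l / algebraMap D K a := by
      rw [hsK]; field_simp
    rw [e1, e2]
    field_simp

theorem exists_vClosure_add_pow_eq_spanSingleton (hD : IsAGCDDomain D) {x y : K} (hx : x ≠ 0)
    (hy : y ≠ 0) : ∃ n : ℕ, n ≠ 0 ∧ ∃ e : K, e ≠ 0 ∧
      vClosure (spanSingleton D⁰ (x ^ n) + spanSingleton D⁰ (y ^ n)) = spanSingleton D⁰ e := by
  obtain ⟨a, c, hc, rfl⟩ := IsFractionRing.div_surjective (A := D) x
  obtain ⟨b, d, hd, rfl⟩ := IsFractionRing.div_surjective (A := D) y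
  have hcK : algebraMap D K c ≠ 0 := IsFractionRing.to_map_ne_zero_of_mem_nonZeroDivisors hc
  have hdK : algebraMap D K d ≠ 0 := IsFractionRing.to_map_ne_zero_of_mem_nonZeroDivisors hd
  have ha : a ≠ 0 := by rintro rfl; simp at hx
  have hb : b ≠ 0 := by rintro rfl; simp at hy
  -- The numerators of `a / c` and `b / d` over the common denominator `c d`.
  obtain ⟨n, hn, hp⟩ := hD (a * d) (b * c) (mul_ne_zero ha (nonZeroDivisors.ne_zero hd))
    (mul_ne_zero hb (nonZeroDivisors.ne_zero hc))
  refine ⟨n, Nat.one_le_iff_ne_zero.1 hn, ?_⟩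
  obtain ⟨e, he, h⟩ := vClosure_add_spanSingleton_of_isPrincipal
    (pow_ne_zero n (mul_ne_zero ha (nonZeroDivisors.ne_zero hd)))
    (pow_ne_zero n (mul_ne_zero hb (nonZeroDivisors.ne_zero hc))) hp
    ((algebraMap D K c * algebraMap D K d) ^ n) (pow_ne_zero n (mul_ne_zero hcK hdK))
  refine ⟨e, he, ?_⟩
  rw [← h, map_pow, map_pow, ← div_pow, ← div_pow, map_mul, map_mul,
    mul_div_mul_right _ _ hdK, mul_comm (algebraMap D K b), mul_div_mul_left _ _ hcK]

/-- Induct on generators, writing `I = J + (y)`. If `(Jⁿ)_v = (d)` and `(dᵐ, y ^ (n m))_v = (e)`,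
then with `N = n m` both `J ^ N` and `y ^ N` lie in `(e)`; integral closedness extends this to the
mixed terms of `I ^ N`. -/
theorem exists_vClosure_pow_eq_spanSingleton (hD : IsAGCDDomain D) [IsIntegrallyClosed D]
    {I : FractionalIdeal D⁰ K} (hI : I ≠ 0) (hfg : (I : Submodule D K).FG) :
    ∃ n : ℕ, n ≠ 0 ∧ ∃ e : K, e ≠ 0 ∧ vClosure (I ^ n) = spanSingleton D⁰ e := by
  classical
  have key : ∀ T : Finset K, ∀ I : FractionalIdeal D⁰ K, I ≠ 0 →
      (I : Submodule D K) = Submodule.span D (T : Set K) →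
      ∃ n : ℕ, n ≠ 0 ∧ ∃ e : K, e ≠ 0 ∧ vClosure (I ^ n) = spanSingleton D⁰ e := by
    intro T
    induction T using Finset.induction_on with
    | empty =>
      intro I hI h
      refine absurd (coeToSubmodule_injective ?_) hI
      simpa using h
    | insert y T _ ih =>
      intro I hI h
      have hJfg : (Submodule.span D (T : Set K)).FG := ⟨T, rfl⟩
      let J : FractionalIdeal D⁰ K := ⟨Submodule.span D (T : Set K), isFractional_of_fg hJfg⟩
      have hIJ : I = J + spanSingleton D⁰ y := by
        refine coeToSubmodule_injective
          (show (I : Submodule D K) = ((J + spanSingleton D⁰ y : FractionalIdeal D⁰ K) : _) from ?_)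
        rw [h, Finset.coe_insert, Submodule.span_insert, coe_add, coe_spanSingleton, sup_comm]
        rfl
      by_cases hJ : J = 0
      · rw [hJ, zero_add] at hIJ
        refine ⟨1, one_ne_zero, y, ?_, by rw [pow_one, hIJ, vClosure_spanSingleton]⟩
        rintro rfl
        exact hI (by simpa using hIJ)
      by_cases hy : y = 0
      · rw [hy, spanSingleton_zero, add_zero] at hIJ
        exact hIJ ▸ ih J hJ rfl
      obtain ⟨n, hn, d, hd, hJd⟩ := ih J hJ rfl
      obtain ⟨m, hm, e, he, hde⟩ := exists_vClosure_add_pow_eq_spanSingleton hD hd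
        (pow_ne_zero n hy)
      have hN : n * m ≠ 0 := mul_ne_zero hn hm
      have hL : vClosure (J ^ (n * m) + spanSingleton D⁰ (y ^ (n * m))) = spanSingleton D⁰ e := by
        rw [← vClosure_add_left, pow_mul, ← vClosure_pow, hJd, spanSingleton_pow,
          vClosure_spanSingleton, pow_mul, hde]
      have hJL : J ^ (n * m) ≤ spanSingleton D⁰ e := by
        rw [← hL, ← sup_eq_add]; exact le_sup_left.trans (le_vClosure _)
      have hyL : spanSingleton D⁰ y ^ (n * m) ≤ spanSingleton D⁰ e := by
        rw [← hL, ← sup_eq_add, spanSingleton_pow]; exact le_sup_right.trans (le_vClosure _)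
      refine ⟨n * m, hN, e, he, le_antisymm ?_ ?_⟩
      · rw [← vClosure_spanSingleton e]
        refine vClosure_mono ?_
        rw [hIJ]
        refine add_pow_le_of_forall_mul_le fun i hi => ?_
        -- The `N`-th power of an element of `Jⁱ (y) ^ (N - i)` lies in `(J ^ N)ⁱ ((y) ^ N) ^ (N -
        -- i)`, hence in `(e ^ N)`.
        refine le_spanSingleton_of_forall_pow_mem hN he fun x hx => ?_
        have hx := pow_mem_pow hx (n * m)
        rw [mul_pow, pow_right_comm, pow_right_comm _ (n * m - i)] at hx
        have := mul_le_mul' (pow_le_of_le_spanSingleton hJL i)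
          (pow_le_of_le_spanSingleton hyL (n * m - i)) hx
        rwa [spanSingleton_mul_spanSingleton, ← pow_add, Nat.add_sub_cancel' hi] at this
      · rw [← hL]
        refine vClosure_mono ?_
        rw [hIJ, ← sup_eq_add, ← sup_eq_add, ← spanSingleton_pow]
        exact sup_le (pow_le_pow_left' le_sup_left _) (pow_le_pow_left' le_sup_right _)
  obtain ⟨T, hT⟩ := hfg
  exact key T I hI hT.symm

theorem isTInvertible_of_fg (hD : IsAGCDDomain D) [IsIntegrallyClosed D]
    {I : FractionalIdeal D⁰ K} (hI : I ≠ 0) (hfg : (I : Submodule D K).FG) :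
    IsTInvertible I := by
  obtain ⟨n, hn, e, he, h⟩ := exists_vClosure_pow_eq_spanSingleton hD hI hfg
  -- Since `(Iⁿ)_t = (e)`, the ideal `e⁻¹ I ^ (n - 1)` is a `t`-inverse of `I`.
  refine .of_mul (J := I ^ (n - 1) * spanSingleton D⁰ e⁻¹) hI ?_
  rw [← mul_assoc, mul_pow_sub_one hn, ← tClosure_mul_left,
    tClosure_eq_vClosure_of_fg (coe_pow_fg hfg n), h, spanSingleton_mul_spanSingleton,
    mul_inv_cancel₀ he, spanSingleton_one, tClosure_one]

/-- That `1` lies in `(I I⁻¹)_t` involves only finitely many elements of `I`. The ideal `J` they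
generate satisfies `(J I⁻¹)_t = D`, and multiplying by `I` gives `J_t = I_t`. -/
theorem IsTInvertible.exists_fg_tClosure_eq {I : FractionalIdeal D⁰ K} (h : IsTInvertible I) :
    ∃ J : FractionalIdeal D⁰ K, (J : Submodule D K).FG ∧ J ≤ I ∧ tClosure J = tClosure I := by
  have h1 : (1 : K) ∈ tClosure (I * I⁻¹) := h ▸ one_mem_one D⁰
  obtain ⟨L, hL, hLI, h1L⟩ := mem_tClosure.1 h1
  obtain ⟨J, hJ, hJI, hLJ⟩ := exists_fg_le_mul hL hLI
  have hJ1 : tClosure (J * I⁻¹) = 1 := by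
    refine le_antisymm (h ▸ tClosure_mono (mul_le_mul' hJI le_rfl)) ?_
    rw [← spanSingleton_one, spanSingleton_le_iff_mem]
    exact mem_tClosure.2 ⟨L, hL, hLJ, h1L⟩
  refine ⟨J, hJ, hJI, ?_⟩
  calc tClosure J = tClosure (J * tClosure (I * I⁻¹)) := by rw [h, mul_one]
    _ = tClosure (tClosure (J * I⁻¹) * I) := by
      rw [tClosure_mul_right, tClosure_mul_left, mul_right_comm, mul_assoc]
    _ = tClosure I := by rw [hJ1, one_mul]

theorem tClosure_pow (I : FractionalIdeal D⁰ K) (n : ℕ) :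
    tClosure (tClosure I ^ n) = tClosure (I ^ n) := by
  induction n with
  | zero => simp
  | succ n ih =>
    rw [pow_succ, pow_succ, tClosure_mul_right, ← tClosure_mul_left, ih, tClosure_mul_left]

theorem TInv.pow_val (I : TInv D K) (n : ℕ) : (I ^ n).1 = tClosure (I.1 ^ n) := by
  induction n with
  | zero => rw [pow_zero, pow_zero, tClosure_one, TInv.one_val]
  | succ n ih => rw [pow_succ, pow_succ, TInv.mul_val, ih, tClosure_mul_left]

theorem isMulTorsion_tClassGroup (hD : IsAGCDDomain D) [IsIntegrallyClosed D] :
    IsMulTorsion (TClassGroup D K) := by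
  intro g
  induction g using QuotientGroup.induction_on with | H I =>
  obtain ⟨J, hJ, -, hJI⟩ := I.2.2.2.exists_fg_tClosure_eq
  have hJ0 : J ≠ 0 := by
    rintro rfl
    rw [I.2.2.1] at hJI
    exact I.2.1 (le_antisymm (hJI ▸ (tClosure_le_vClosure 0).trans vClosure_zero.le) (zero_le _))
  obtain ⟨n, hn, e, he, h⟩ := exists_vClosure_pow_eq_spanSingleton hD hJ0 hJ
  refine isOfFinOrder_iff_pow_eq_one.2 ⟨n, Nat.pos_of_ne_zero hn, ?_⟩
  rw [← QuotientGroup.mk_pow, QuotientGroup.eq_one_iff]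
  refine ⟨e, he, ?_⟩
  rw [TInv.pow_val, ← tClosure_pow, ← hJI, tClosure_pow,
    tClosure_eq_vClosure_of_fg (coe_pow_fg hJ n), h]

end

end StarOp

theorem corollary2p17 (D : Type*) [CommRing D] [IsDomain D] (hD : IsAGCDDomain D) :
    [IsIntegrallyClosed (PowerSeries D),
      IsCompletelyIntegrallyClosed (PowerSeries D),
      IsCompletelyIntegrallyClosed D,
      IsCompletelyIntegrallyClosed D ∧ StarOp.IsPVMD D ∧
        IsMulTorsion (StarOp.TClassGroup D (FractionRing D))].TFAE := by
  tfae_have 1 → 3 := fun _ => hD.isCompletelyIntegrallyClosed_of_powerSeries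
  tfae_have 3 → 2 := fun h => h.powerSeries
  tfae_have 2 → 1 := fun h => h.isIntegrallyClosed
  tfae_have 3 → 4 := fun h => by
    have := h.isIntegrallyClosed
    exact ⟨h, fun _ hI hfg => StarOp.isTInvertible_of_fg hD hI hfg,
      StarOp.isMulTorsion_tClassGroup hD⟩
  tfae_have 4 → 3 := fun h => h.1
  tfae_finish
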